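/- Let $W\in\mathbb{C}[x_1,\dots,x_N]$ be quasihomogeneous of degree $d>0$ with positive integer weights $c_1,\dots,c_N$, let $q_i=c_i/d$ be its charges, and let $c_W=\sum_{i=1}^N(1-2q_i)$. Assume that $W$ is nondegenerate (the origin is its only critical point, and it has no monomial $x_ix_j$ with $i\neq j$) and invertible (it has exactly $N$ monomials). Let $G$ be a group of diagonal matrices with entries in $U(1)$ that preserve $W$, and assume $J=\mathrm{diag}(e^{2\pi i q_1},\dots,e^{2\pi i q_N})\in G$. For $g\in G$ let $W_g$ be the restriction of $W$ to the coordinate subspace $\mathrm{Fix}(g)\subseteq\mathbb{C}^N$, of dimension $n=n_g$, let $d\underline{x}_g$ be the product of the $dx_i$ with $g_i=1$, and let $\Omega_{W_g}=\Omega^{n}(\mathrm{Fix}(g))/(dW_g\wedge\Omega^{n-1}(\mathrm{Fix}(g)))$ (polynomial forms), graded by $\deg(\phi\,d\underline{x}_g)=\deg\phi+\sum_{g_i=1}q_i$, where $\deg x_i=q_i$. Let $\Omega_{W,G}=\bigl(\bigoplus_{g\in G}\Omega_{W_g}\bigr)^G$, with $G$ acting by pullback. Writing $g=\mathrm{diag}(e^{2\pi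 i\Theta_1},\dots,e^{2\pi i\Theta_N})$ with $\Theta_i\in[0,1)$, put $\iota_{(g)}=\sum_i\Theta_i$ and $$Q^B_-(g)=\iota_{(g^{-1})}-\sum_{i=1}^N q_i,\qquad Q^B_+(g)=\iota_{(g)}-\sum_{i=1}^N q_i .$$ The shifted bidegree of a homogeneous element $\phi\,d\underline{x}_g$ of the $g$-sector is $(\deg_W^-,\deg_W^+)=(\deg(\phi\,d\underline{x}_g)+Q^B_-(g),\ \deg(\phi\,d\underline{x}_g)+Q^B_+(g))$. The residue pairing between the $g$-sector and the $g^{-1}$-sector is defined, using $\mathrm{Fix}(g)=\mathrm{Fix}(g^{-1})$, by $$\langle\phi_1\,d\underline{x}_g,\ \phi_2\,d\underline{x}_{g^{-1}}\rangle=\frac{1}{(2\pi i)^{n}}\int_{|\partial_iW_g|=\varepsilon}\frac{\phi_1\phi_2\,d\underline{x}_g}{\prod_{i}\partial_iW_g},$$ where $i$ runs over the indices with $g_i=1$, $\varepsilon>0$, and the cycle is oriented by $\bigwedge_i d\arg(\partial_iW_g)>0$. Then for every $g\in G$ and all homogeneous $\phi_1\,d\underline{x}_g$ in the $g$-sector and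 $\phi_2\,d\underline{x}_{g^{-1}}$ in the $g^{-1}$-sector with $\langle\phi_1\,d\underline{x}_g,\phi_2\,d\underline{x}_{g^{-1}}\rangle\neq0$, $$\deg_W^{-}(\phi_1\,d\underline{x}_g)+\deg_W^{-}(\phi_2\,d\underline{x}_{g^{-1}})=c_W\quad\text{and}\quad\deg_W^{+}(\phi_1\,d\underline{x}_g)+\deg_W^{+}(\phi_2\,d\underline{x}_{g^{-1}})=c_W .$$ This holds both for homogeneous forms and for homogeneous classes in $\Omega_{W,G}$. -/

import Mathlib

open MvPolynomial MeasureTheory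

namespace LG

noncomputable section

/-! ### Quasihomogeneous polynomials, charges, symmetries -/

/-- `W` is quasihomogeneous with (positive integer) weights `c` and (positive) degree `d`. -/
structure IsQuasihomogeneous {N : ℕ} (W : MvPolynomial (Fin N) ℂ) (c : Fin N → ℕ) (d : ℕ) :
    Prop where
  degree_pos : 0 < d
  weight_pos : ∀ i, 0 < c i
  homogeneous : W.IsWeightedHomogeneous c d

/-- Nondegeneracy: the origin is the only critical point of `W`, and `W` has no monomial
`x_i x_j` with `i ≠ j`. -/
structure IsNondegenerate {N : ℕ} (W : MvPolynomial (Fin N) ℂ) : Prop where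
  critical_iff : ∀ x : Fin N → ℂ, (∀ i, eval x (pderiv i W) = 0) ↔ x = 0
  no_cross_term : ∀ i j, i ≠ j → coeff (Finsupp.single i 1 + Finsupp.single j 1) W = 0

/-- Invertibility: as many monomials as variables. -/
def IsInvertible {N : ℕ} (W : MvPolynomial (Fin N) ℂ) : Prop := W.support.card = N

/-- The charges `q_i = c_i / d`. -/
def charge {N : ℕ} (c : Fin N → ℕ) (d : ℕ) (i : Fin N) : ℝ := (c i : ℝ) / (d : ℝ)

/-- The central charge `c_W = ∑ (1 - 2 q_i)`. -/
def centralCharge {N : ℕ} (c : Fin N → ℕ) (d : ℕ) : ℝ := ∑ i, (1 - 2 * charge c d i)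

/-- The maximal diagonal symmetry group: diagonal matrices `diag(g_1, …, g_N)` with entries
`g_j = e^{2πi θ_j}` on the unit circle such that `W(g x) = W(x)`. -/
def maxSymm {N : ℕ} (W : MvPolynomial (Fin N) ℂ) : Subgroup (Fin N → Circle) where
  carrier := {g | ∀ x : Fin N → ℂ, eval (fun i => (g i : ℂ) * x i) W = eval x W}
  one_mem' := by intro x; simp
  mul_mem' := by
    intro a b ha hb x
    have := ha (fun i => (b i : ℂ) * x i)
    rw [hb x] at this
    simpa [mul_assoc] using this
  inv_mem' := by
    intro a ha x
    have := ha (fun i => ((a i)⁻¹ : ℂ) * x i)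
    simpa using this.symm

/-- The distinguished element `J = diag(e^{2πi q_1}, …, e^{2πi q_N})`. -/
def J {N : ℕ} (c : Fin N → ℕ) (d : ℕ) : Fin N → Circle :=
  fun i => Circle.exp (2 * Real.pi * charge c d i)

/-- The `i`-th phase of `g`: the number `Θ_i ∈ [0,1)` with `g_i = e^{2πi Θ_i}`. -/
def phase {N : ℕ} (g : Fin N → Circle) (i : Fin N) : ℝ :=
  Int.fract (Complex.arg (g i : ℂ) / (2 * Real.pi))

/-- The age `ι_(g) = ∑ Θ_i`. -/
def age {N : ℕ} (g : Fin N → Circle) : ℝ := ∑ i, phase g i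

/-- The degree shift `Q^B_-(g) = ι_(g⁻¹) - ∑ q_i`. -/
def shiftMinus {N : ℕ} (c : Fin N → ℕ) (d : ℕ) (g : Fin N → Circle) : ℝ :=
  age g⁻¹ - ∑ i, charge c d i

/-- The degree shift `Q^B_+(g) = ι_(g) - ∑ q_i`. -/
def shiftPlus {N : ℕ} (c : Fin N → ℕ) (d : ℕ) (g : Fin N → Circle) : ℝ :=
  age g - ∑ i, charge c d i

open Classical in
/-- The coordinates fixed by `g`; `Fix(g)` is the coordinate subspace `ℂ^(fixIdx g)` of `ℂ^N`. -/
def fixIdx {N : ℕ} (g : Fin N → Circle) : Finset (Fin N) := Finset.univ.filter fun i => g i = 1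

/-- `Fix(g⁻¹) = Fix(g)`. -/
theorem fixIdx_inv {N : ℕ} (g : Fin N → Circle) : fixIdx g⁻¹ = fixIdx g := by
  ext i; simp [fixIdx]

open Classical in
/-- Restriction of a polynomial to the coordinate subspace `ℂ^S ⊆ ℂ^N` (the coordinates outside
`S` are set to zero). -/
def restrict {N : ℕ} (W : MvPolynomial (Fin N) ℂ) (S : Finset (Fin N)) : MvPolynomial S ℂ :=
  aeval (fun i => if h : i ∈ S then (X ⟨i, h⟩ : MvPolynomial S ℂ) else 0) W

/-! ### The spaces `Ω_{W_g}`

A top-degree polynomial form `φ dx_S` on `ℂ^S` is represented by its coefficient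
`φ : MvPolynomial S ℂ`. -/

/-- Wedge product with `dV` from forms of degree one less than the top degree to top forms:
`η = ∑ (-1)^(i-1) a_i dx_1 ⋯ (omit dx_i) ⋯ dx_n` goes to `dV ∧ η = (∑ a_i ∂_i V) dx`. -/
def wedgeD {σ : Type} [Fintype σ] (V : MvPolynomial σ ℂ) :
    (σ → MvPolynomial σ ℂ) →ₗ[ℂ] MvPolynomial σ ℂ where
  toFun a := ∑ i, a i * pderiv i V
  map_add' a b := by simp [add_mul, Finset.sum_add_distrib]
  map_smul' r a := by simp [Finset.smul_sum]

/-- `Ω_{W|ℂ^S} = Ω^top(ℂ^S) / (dW ∧ Ω^(top-1)(ℂ^S))`. -/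
abbrev Omega {N : ℕ} (W : MvPolynomial (Fin N) ℂ) (S : Finset (Fin N)) : Type :=
  MvPolynomial S ℂ ⧸ LinearMap.range (wedgeD (restrict W S))

/-- Top forms `φ dx_S` on `ℂ^S` that are homogeneous of degree `p`, where
`deg (φ dx_S) = deg φ + ∑_{i ∈ S} q_i` and `x_i` has degree `q_i`. -/
def homForms {N : ℕ} (c : Fin N → ℕ) (d : ℕ) (S : Finset (Fin N)) (p : ℝ) :
    Submodule ℂ (MvPolynomial S ℂ) :=
  weightedHomogeneousSubmodule ℂ (fun i : S => charge c d i) (p - ∑ i ∈ S, charge c d i)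

/-- The degree `p` part of `Ω_{W|ℂ^S}`. -/
def omegaDeg {N : ℕ} (W : MvPolynomial (Fin N) ℂ) (c : Fin N → ℕ) (d : ℕ) (S : Finset (Fin N))
    (p : ℝ) : Submodule ℂ (Omega W S) :=
  (homForms c d S p).map (LinearMap.range (wedgeD (restrict W S))).mkQ

open Classical in
/-- The unshifted (internal) bigrading: the single grading placed on the diagonal. -/
def omegaBideg {N : ℕ} (W : MvPolynomial (Fin N) ℂ) (c : Fin N → ℕ) (d : ℕ) (S : Finset (Fin N))
    (p q : ℝ) : Submodule ℂ (Omega W S) :=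
  if p = q then omegaDeg W c d S p else ⊥

/-! ### The group action and the space `Ω_{W,G}` -/

/-- `φ(x) ↦ φ(h x)` for functions on `ℂ^S`. -/
def scale {N : ℕ} (h : Fin N → Circle) (S : Finset (Fin N)) :
    MvPolynomial S ℂ →ₐ[ℂ] MvPolynomial S ℂ :=
  aeval fun i => C (h i : ℂ) * X i

/-- Pullback of top forms under multiplication by `h`:
`φ(x) dx_S ↦ φ(h x) (∏_{i ∈ S} h_i) dx_S`. -/
def pullback {N : ℕ} (h : Fin N → Circle) (S : Finset (Fin N)) :
    MvPolynomial S ℂ →ₗ[ℂ] MvPolynomial S ℂ :=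
  (∏ i ∈ S, (h i : ℂ)) • (scale h S).toLinearMap

theorem pderiv_scale {N : ℕ} (h : Fin N → Circle) (S : Finset (Fin N)) (i : S)
    (φ : MvPolynomial S ℂ) :
    pderiv i (scale h S φ) = C (h i : ℂ) * scale h S (pderiv i φ) := by
  induction φ using MvPolynomial.induction_on with
  | C a => simp [scale]
  | add p q hp hq => simp [hp, hq, mul_add]
  | mul_X p j hp =>
    have hX : ∀ j : S, scale h S (X j) = C (h j : ℂ) * X j := fun j => by simp [scale]
    simp only [map_mul, Derivation.leibniz, hp, hX, smul_eq_mul, map_add]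
    by_cases hij : i = j
    · subst hij; simp; ring
    · simp [pderiv_X, Ne.symm hij]; ring

theorem scale_restrict {N : ℕ} {W : MvPolynomial (Fin N) ℂ} {h : Fin N → Circle}
    (hh : h ∈ maxSymm W) (S : Finset (Fin N)) : scale h S (restrict W S) = restrict W S := by
  classical
  apply MvPolynomial.funext
  intro x
  have key : ∀ z : S → ℂ, eval z (restrict W S)
      = eval (fun i => if hi : i ∈ S then z ⟨i, hi⟩ else 0) W := by
    intro z
    simp only [restrict, ← coe_aeval_eq_eval, RingHom.coe_coe]
    rw [comp_aeval_apply]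
    congr 2
    funext i
    split_ifs <;> simp
  have e1 : eval x (scale h S (restrict W S))
      = eval (fun i : S => (h i : ℂ) * x i) (restrict W S) := by
    simp only [scale, ← coe_aeval_eq_eval, RingHom.coe_coe]
    rw [comp_aeval_apply]
    congr 2
    funext i
    simp
  rw [e1, key, key, ← hh fun i => if hi : i ∈ S then x ⟨i, hi⟩ else 0]
  congr 2
  funext i
  split_ifs <;> simp

theorem range_le_comap_pullback {N : ℕ} {W : MvPolynomial (Fin N) ℂ} {h : Fin N → Circle}
    (hh : h ∈ maxSymm W) (S : Finset (Fin N)) :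
    LinearMap.range (wedgeD (restrict W S)) ≤
      (LinearMap.range (wedgeD (restrict W S))).comap (pullback h S) := by
  rintro _ ⟨a, rfl⟩
  have hd : ∀ i : S, scale h S (pderiv i (restrict W S))
      = C ((h i : ℂ)⁻¹) * pderiv i (restrict W S) := by
    intro i
    have h1 := pderiv_scale h S i (restrict W S)
    rw [scale_restrict hh] at h1
    conv_rhs => rw [h1, ← mul_assoc, ← C_mul, inv_mul_cancel₀ (Circle.coe_ne_zero _)]
    simp
  refine ⟨fun i => (∏ i ∈ S, (h i : ℂ)) • (scale h S (a i) * C ((h i : ℂ)⁻¹)), ?_⟩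
  simp only [wedgeD, pullback, LinearMap.coe_mk, AddHom.coe_mk, LinearMap.smul_apply,
    AlgHom.toLinearMap_apply, map_sum, map_mul, hd, smul_mul_assoc, mul_assoc]

/-- The action of a symmetry `h` on `Ω_{W|ℂ^S}` by pullback. -/
def omegaAct {N : ℕ} {W : MvPolynomial (Fin N) ℂ} {h : Fin N → Circle} (hh : h ∈ maxSymm W)
    (S : Finset (Fin N)) : Omega W S →ₗ[ℂ] Omega W S :=
  Submodule.mapQ _ _ (pullback h S) (range_le_comap_pullback hh S)

/-- `⨁_{g ∈ G} Ω_{W_g}`, with `W_g` the restriction of `W` to `Fix(g)`. -/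
abbrev SectorSum {N : ℕ} (W : MvPolynomial (Fin N) ℂ) (G : Subgroup (Fin N → Circle)) : Type :=
  DirectSum G fun g => Omega W (fixIdx (g : Fin N → Circle))

/-- The action of `h ∈ G` on `⨁_{g ∈ G} Ω_{W_g}`. It sends the sector of `g` to the sector of
`h⁻¹ g h`, which is the sector of `g` because diagonal matrices commute. -/
def sectorAct {N : ℕ} {W : MvPolynomial (Fin N) ℂ} {G : Subgroup (Fin N → Circle)}
    (hG : G ≤ maxSymm W) (h : G) : SectorSum W G →ₗ[ℂ] SectorSum W G :=
  DirectSum.lmap fun g => omegaAct (hG h.2) (fixIdx (g : Fin N → Circle))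

/-- The B-model cohomology `Ω_{W,G}`: the `G`-invariants of `⨁_{g ∈ G} Ω_{W_g}`. -/
def OmegaG {N : ℕ} {W : MvPolynomial (Fin N) ℂ} {G : Subgroup (Fin N → Circle)}
    (hG : G ≤ maxSymm W) : Submodule ℂ (SectorSum W G) :=
  ⨅ h : G, LinearMap.eqLocus (sectorAct hG h) LinearMap.id

/-- The part of `Ω_{W,G}` of shifted bidegree `(deg⁻, deg⁺) = (p, q)`:
the `G`-invariants of `⨁_g Ω_{W_g}^{p - Q^B_-(g), q - Q^B_+(g)}`. -/
def OmegaGBideg {N : ℕ} {W : MvPolynomial (Fin N) ℂ} {G : Subgroup (Fin N → Circle)}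
    (hG : G ≤ maxSymm W) (c : Fin N → ℕ) (d : ℕ) (p q : ℝ) : Submodule ℂ (SectorSum W G) :=
  OmegaG hG ⊓ ⨅ g : G, (omegaBideg W c d (fixIdx (g : Fin N → Circle))
    (p - shiftMinus c d g) (q - shiftPlus c d g)).comap
      (DirectSum.component ℂ G (fun g => Omega W (fixIdx (g : Fin N → Circle))) g)

/-! ### The residue pairing -/

/-- The cycle `{x ∈ ℂ^σ : |∂_i V(x)| = ε for all i}`. -/
def cycle {σ : Type} [Fintype σ] (V : MvPolynomial σ ℂ) (ε : ℝ) : Set (EuclideanSpace ℂ σ) :=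
  {x | ∀ i, ‖eval x.ofLp (pderiv i V)‖ = ε}

/-- The Hessian matrix `(∂_i ∂_j V)(x)`, i.e. the complex Jacobian matrix at `x` of the gradient
map `(∂_1 V, …, ∂_n V)`. -/
def hessian {σ : Type} [Fintype σ] (V : MvPolynomial σ ℂ) (x : EuclideanSpace ℂ σ) :
    Matrix σ σ ℂ :=
  Matrix.of fun i j => eval x.ofLp (pderiv j (pderiv i V))

open Classical in
/-- The tangent frame of `cycle V ε` at `x`, as columns: the `j`-th column is the velocity with
which `x` moves along the cycle when `arg (∂_j V)` increases at unit speed and the other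
`∂_i V` stay fixed. It is a basis of the tangent space wherever the Hessian
determinant does not vanish, which is almost everywhere on the cycle. -/
def frame {σ : Type} [Fintype σ] (V : MvPolynomial σ ℂ) (x : EuclideanSpace ℂ σ) :
    Matrix σ σ ℂ :=
  (hessian V x)⁻¹ * Matrix.diagonal fun j => Complex.I * eval x.ofLp (pderiv j V)

open Classical in
/-- The value of `dx_1 ∧ ⋯ ∧ dx_n` on the unit tangent `n`-vector of `cycle V ε` at `x`, for the
orientation `d arg (∂_1 V) ∧ ⋯ ∧ d arg (∂_n V) > 0`: the value on the frame divided by the real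
`n`-dimensional volume of the parallelepiped that the frame spans. -/
def dxOnTangent {σ : Type} [Fintype σ] (V : MvPolynomial σ ℂ) (x : EuclideanSpace ℂ σ) : ℂ :=
  (frame V x).det /
    (Real.sqrt (((frame V x).conjTranspose * frame V x).map Complex.re).det : ℂ)

/-- The residue
`Res (φ dx / (∂_1 V ⋯ ∂_n V)) = (2πi)^(-n) ∫_{|∂_i V| = ε} φ dx / (∂_1 V ⋯ ∂_n V)`,
where the integral of the form over the oriented `n`-dimensional cycle is the integral, against
`n`-dimensional Euclidean Hausdorff measure, of its value on the unit tangent `n`-vector. -/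
def residue {σ : Type} [Fintype σ] (V : MvPolynomial σ ℂ) (ε : ℝ) (φ : MvPolynomial σ ℂ) : ℂ :=
  ((2 * Real.pi * Complex.I) ^ Fintype.card σ)⁻¹ *
    ∫ x in cycle V ε, eval x.ofLp φ / (∏ i, eval x.ofLp (pderiv i V)) * dxOnTangent V x
      ∂(Measure.euclideanHausdorffMeasure (Fintype.card σ))

/-- Transport of forms along an equality of coordinate subspaces. -/
def castForm {N : ℕ} {S T : Finset (Fin N)} (h : T = S) (φ : MvPolynomial T ℂ) :
    MvPolynomial S ℂ :=
  rename (fun i : T => (⟨i.1, h ▸ i.2⟩ : S)) φ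

/-- The residue pairing `⟨φ₁ dx_g, φ₂ dx_{g⁻¹}⟩` of forms on `Fix(g)` and `Fix(g⁻¹) = Fix(g)`. -/
def formPairing {N : ℕ} (W : MvPolynomial (Fin N) ℂ) (ε : ℝ) (g : Fin N → Circle)
    (φ₁ : MvPolynomial (fixIdx g) ℂ) (φ₂ : MvPolynomial (fixIdx g⁻¹) ℂ) : ℂ :=
  residue (restrict W (fixIdx g)) ε (φ₁ * castForm (fixIdx_inv g) φ₂)

open Classical in
/-- The residue pairing `Ω_{W_g} × Ω_{W_{g⁻¹}} → ℂ` of classes: the common value of the residue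
pairing on all pairs of representing forms. It exists because residues with a numerator in
`dW_g ∧ Ω^(top-1)` vanish; the value `0` is a convention for the case that it did not exist. -/
def pairing {N : ℕ} (W : MvPolynomial (Fin N) ℂ) (ε : ℝ) (g : Fin N → Circle)
    (ω₁ : Omega W (fixIdx g)) (ω₂ : Omega W (fixIdx g⁻¹)) : ℂ :=
  if h : ∃ z : ℂ, ∀ φ₁ φ₂, Submodule.Quotient.mk φ₁ = ω₁ → Submodule.Quotient.mk φ₂ = ω₂ →
      formPairing W ε g φ₁ φ₂ = z
  then h.choose else 0

end

end LG

/-! The circle `x_i ↦ e^{itq_i} x_i` acts on `ℂ^n` by unitary maps. It multiplies each homogeneous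
polynomial by a phase, so it preserves the cycle `|∂_i V| = ε` and its Hausdorff measure, and it
multiplies the residue integrand of a weight `m` numerator by `e^{it(m - ∑(1 - 2q_i))}`. The residue
therefore equals that phase times itself for every `t`, and can be nonzero only if `m = ∑(1 - 2q_i)`
(`eq_of_residue_ne_zero`). This uses neither convergence of the integral nor its independence of
`ε`.

On `Fix(g)`, counting the charges of the two volume forms, nonzero pairing forces the internal
degrees to add up to `n_g`. Since `ι_(g) + ι_(g⁻¹) = N - n_g` (`age_add_age_inv`), either pair of
shifts adds up to `N - n_g - 2∑q_i`, and the total is `c_W`. -/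

namespace LG

noncomputable section

/-! ### Circle symmetry of the residue -/

section Weights

variable {σ : Type}

theorem exp_weight (w : σ → ℝ) (t : ℝ) (m : σ →₀ ℕ) :
    (m.prod fun i k => (Circle.exp (t * w i) : ℂ) ^ k)
      = (Circle.exp (t * Finsupp.weight w m) : ℂ) := by
  rw [Finsupp.weight_apply, Finsupp.sum, Finsupp.prod, Finset.mul_sum]
  simp only [Circle.coe_exp, ← Complex.exp_nat_mul, ← Complex.exp_sum, Complex.ofReal_sum,
    Finset.sum_mul]
  congr 1
  refine Finset.sum_congr rfl fun i _ => ?_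
  push_cast [nsmul_eq_mul]
  ring

theorem isWeightedHomogeneous_pderiv {w : σ → ℝ} {p : MvPolynomial σ ℂ} {m : ℝ}
    (hp : p.IsWeightedHomogeneous w m) (i : σ) :
    (pderiv i p).IsWeightedHomogeneous w (m - w i) :=
  hp.pderiv (by ring)

variable [Fintype σ]

/-- The circle action `x_i ↦ e^{i t w_i} x_i` on `ℂ^σ` with real weights `w`, as an isometry. -/
def weightRotation (w : σ → ℝ) (t : ℝ) : EuclideanSpace ℂ σ ≃ₗᵢ[ℝ] EuclideanSpace ℂ σ :=
  LinearIsometryEquiv.piLpCongrRight 2 fun i => rotation (Circle.exp (t * w i))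

theorem weightRotation_ofLp (w : σ → ℝ) (t : ℝ) (x : EuclideanSpace ℂ σ) :
    (weightRotation w t x).ofLp = fun i => (Circle.exp (t * w i) : ℂ) * x i := by
  funext i
  simp [weightRotation]

theorem eval_weightRotation {w : σ → ℝ} {p : MvPolynomial σ ℂ} {m : ℝ}
    (hp : p.IsWeightedHomogeneous w m) (t : ℝ) (x : EuclideanSpace ℂ σ) :
    eval (weightRotation w t x).ofLp p = (Circle.exp (t * m) : ℂ) * eval x.ofLp p := by
  rw [weightRotation_ofLp, eval_eq, eval_eq, Finset.mul_sum]
  refine Finset.sum_congr rfl fun k hk => ?_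
  have h := exp_weight w t k
  rw [hp (mem_support_iff.1 hk), Finsupp.prod] at h
  simp only [mul_pow, Finset.prod_mul_distrib, h]
  ring

open Classical in
/-- The diagonal unitary matrix with entries `e^{i t w_i}`. -/
def weightMatrix (w : σ → ℝ) (t : ℝ) : Matrix σ σ ℂ :=
  Matrix.diagonal fun i => (Circle.exp (t * w i) : ℂ)

open Classical in
theorem det_weightMatrix (w : σ → ℝ) (t : ℝ) :
    (weightMatrix w t).det = (Circle.exp (t * ∑ i, w i) : ℂ) := by
  rw [weightMatrix, Matrix.det_diagonal, Finset.mul_sum]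
  simp [← Complex.exp_sum, Finset.sum_mul]

open Classical in
theorem conjTranspose_weightMatrix_mul (w : σ → ℝ) (t : ℝ) :
    (weightMatrix w t).conjTranspose * weightMatrix w t = 1 := by
  rw [weightMatrix, Matrix.diagonal_conjTranspose, Matrix.diagonal_mul_diagonal,
    ← Matrix.diagonal_one]
  congr 1
  funext i
  rw [Pi.star_apply, Complex.star_def, ← Circle.coe_inv_eq_conj, Circle.coe_inv,
    inv_mul_cancel₀ (Circle.coe_ne_zero _)]

open Classical in
theorem weightMatrix_mul_neg (w : σ → ℝ) (t : ℝ) :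
    weightMatrix w t * weightMatrix w (-t) = 1 := by
  rw [weightMatrix, weightMatrix, Matrix.diagonal_mul_diagonal, ← Matrix.diagonal_one]
  congr 1
  funext i
  simp

variable {w : σ → ℝ} {V : MvPolynomial σ ℂ}

theorem cycle_weightRotation (hV : V.IsWeightedHomogeneous w 1) (t ε : ℝ) :
    weightRotation w t ⁻¹' cycle V ε = cycle V ε := by
  ext x
  simp only [cycle, Set.mem_preimage, Set.mem_ofPred_eq,
    eval_weightRotation (isWeightedHomogeneous_pderiv hV _), norm_mul, Circle.norm_coe, one_mul]

/-- The entry `∂_i ∂_j V` has weight `1 - w_i - w_j`. -/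
theorem hessian_weightRotation (hV : V.IsWeightedHomogeneous w 1) (t : ℝ)
    (x : EuclideanSpace ℂ σ) :
    hessian V (weightRotation w t x)
      = (Circle.exp t : ℂ) • (weightMatrix w (-t) * hessian V x * weightMatrix w (-t)) := by
  ext i j
  simp only [hessian, weightMatrix, Matrix.smul_apply, Matrix.mul_diagonal, Matrix.diagonal_mul,
    Matrix.of_apply, smul_eq_mul, eval_weightRotation
      (isWeightedHomogeneous_pderiv (isWeightedHomogeneous_pderiv hV i) j)]
  have : (Circle.exp (t * (1 - w i - w j)) : ℂ)
      = Circle.exp t * Circle.exp (-t * w i) * Circle.exp (-t * w j) := by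
    simp only [← Circle.coe_mul, ← Circle.exp_add]
    refine congrArg (fun r => (Circle.exp r : ℂ)) ?_
    ring
  rw [this]
  ring

-- The rotation is linear and shifts each `arg ∂_j V` by a constant, so it carries the frame to the
-- frame. Where the Hessian is singular, its matrix inverse is `0` by convention, and the identity
-- persists because `Matrix.mul_inv_rev` needs no invertibility.
open Classical in
theorem frame_weightRotation (hV : V.IsWeightedHomogeneous w 1) (t : ℝ)
    (x : EuclideanSpace ℂ σ) :
    frame V (weightRotation w t x) = weightMatrix w t * frame V x := by
  have hinv : (weightMatrix w (-t))⁻¹ = weightMatrix w t :=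
    Matrix.inv_eq_left_inv (weightMatrix_mul_neg w t)
  have hgrad : (Matrix.diagonal fun j => Complex.I *
        eval (weightRotation w t x).ofLp (pderiv j V))
      = (Circle.exp t : ℂ) • (weightMatrix w (-t) *
        Matrix.diagonal fun j => Complex.I * eval x.ofLp (pderiv j V)) := by
    rw [weightMatrix, Matrix.diagonal_mul_diagonal, ← Matrix.diagonal_smul]
    congr 1
    funext j
    have : (Circle.exp (t * (1 - w j)) : ℂ) = Circle.exp t * Circle.exp (-t * w j) := by
      simp only [← Circle.coe_mul, ← Circle.exp_add]
      refine congrArg (fun r => (Circle.exp r : ℂ)) ?_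
      ring
    simp only [eval_weightRotation (isWeightedHomogeneous_pderiv hV j), this, Pi.smul_apply,
      smul_eq_mul]
    ring
  have hhess : (hessian V (weightRotation w t x))⁻¹
      = (Circle.exp t : ℂ)⁻¹ • (weightMatrix w t * (hessian V x)⁻¹ * weightMatrix w t) := by
    rw [hessian_weightRotation hV]
    have hc : (Circle.exp t : ℂ) • (weightMatrix w (-t) * hessian V x * weightMatrix w (-t))
        = ((Circle.exp t : ℂ) • (1 : Matrix σ σ ℂ)) *
          (weightMatrix w (-t) * hessian V x * weightMatrix w (-t)) := by simp
    have hs : ((Circle.exp t : ℂ) • (1 : Matrix σ σ ℂ))⁻¹ = (Circle.exp t : ℂ)⁻¹ • 1 := by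
      apply Matrix.inv_eq_left_inv
      simp [smul_smul]
    rw [hc, Matrix.mul_inv_rev, Matrix.mul_inv_rev, Matrix.mul_inv_rev, hinv, hs]
    simp [mul_assoc]
  rw [frame, hhess, hgrad, frame, smul_mul_smul_comm, inv_mul_cancel₀ (Circle.coe_ne_zero _),
    one_smul]
  calc _ = weightMatrix w t * (hessian V x)⁻¹ * (weightMatrix w t * weightMatrix w (-t)) *
        Matrix.diagonal (fun j => Complex.I * eval x.ofLp (pderiv j V)) := by
        simp only [mul_assoc]
    _ = _ := by rw [weightMatrix_mul_neg, mul_one, mul_assoc]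

/-- Unitarity leaves the Gram matrix of the frame, hence the volume in the denominator, unchanged;
only the determinant of the rotation survives. -/
theorem dxOnTangent_weightRotation (hV : V.IsWeightedHomogeneous w 1) (t : ℝ)
    (x : EuclideanSpace ℂ σ) :
    dxOnTangent V (weightRotation w t x)
      = (Circle.exp (t * ∑ i, w i) : ℂ) * dxOnTangent V x := by
  classical
  have hgram : (frame V (weightRotation w t x)).conjTranspose * frame V (weightRotation w t x)
      = (frame V x).conjTranspose * frame V x := by
    rw [frame_weightRotation hV, Matrix.conjTranspose_mul, mul_assoc,
      ← mul_assoc (weightMatrix w t).conjTranspose, conjTranspose_weightMatrix_mul, one_mul]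
  rw [dxOnTangent, hgram, frame_weightRotation hV, Matrix.det_mul, mul_div_assoc]
  congr 1
  convert det_weightMatrix w t

/-- The residue integrand scales under the circle action by the degree of the numerator minus
`∑ (1 - 2 w_i)`. -/
theorem residue_eq_exp_mul_residue (hV : V.IsWeightedHomogeneous w 1) {φ : MvPolynomial σ ℂ}
    {m : ℝ} (hφ : φ.IsWeightedHomogeneous w m) (ε t : ℝ) :
    residue V ε φ = (Circle.exp (t * (m - ∑ i, (1 - 2 * w i))) : ℂ) * residue V ε φ := by
  have hmp := (weightRotation w t).toIsometryEquiv.measurePreserving_euclideanHausdorffMeasure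
    (Fintype.card σ)
  have hemb := (weightRotation w t).toHomeomorph.measurableEmbedding
  have hint := hmp.setIntegral_preimage_emb hemb
    (fun x => eval x.ofLp φ / (∏ i, eval x.ofLp (pderiv i V)) * dxOnTangent V x) (cycle V ε)
  simp only [LinearIsometryEquiv.coe_toIsometryEquiv, cycle_weightRotation hV] at hint
  rw [residue, mul_left_comm]
  congr 1
  rw [← integral_const_mul, ← hint]
  congr 1
  funext x
  have hprod : (∏ i, eval (weightRotation w t x).ofLp (pderiv i V))
      = (Circle.exp (t * ∑ i, (1 - w i)) : ℂ) * ∏ i, eval x.ofLp (pderiv i V) := by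
    simp only [eval_weightRotation (isWeightedHomogeneous_pderiv hV _), Finset.prod_mul_distrib]
    congr 1
    rw [Finset.mul_sum]
    simp [← Complex.exp_sum, Finset.sum_mul]
  -- The numerator contributes `m`, the volume form `∑ w_i`, and the denominator `-∑ (1 - w_i)`.
  have hexp : (Circle.exp (t * m) : ℂ) * Circle.exp (t * ∑ i, w i)
      = Circle.exp (t * (m - ∑ i, (1 - 2 * w i))) * Circle.exp (t * ∑ i, (1 - w i)) := by
    simp only [← Circle.coe_mul, ← Circle.exp_add]
    refine congrArg (fun r => (Circle.exp r : ℂ)) ?_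
    simp only [Finset.sum_sub_distrib, ← Finset.mul_sum]
    ring
  have hdiv : (Circle.exp (t * m) : ℂ) / Circle.exp (t * ∑ i, (1 - w i)) *
      Circle.exp (t * ∑ i, w i) = Circle.exp (t * (m - ∑ i, (1 - 2 * w i))) := by
    rw [div_mul_eq_mul_div, hexp, mul_div_cancel_right₀ _ (Circle.coe_ne_zero _)]
  rw [eval_weightRotation hφ, hprod, dxOnTangent_weightRotation hV, mul_div_mul_comm, ← hdiv]
  ring

theorem eq_of_residue_ne_zero (hV : V.IsWeightedHomogeneous w 1) {φ : MvPolynomial σ ℂ}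
    {m : ℝ} (hφ : φ.IsWeightedHomogeneous w m) {ε : ℝ} (h : residue V ε φ ≠ 0) :
    m = ∑ i, (1 - 2 * w i) := by
  by_contra hne
  have hne' : m - ∑ i, (1 - 2 * w i) ≠ 0 := sub_ne_zero.2 hne
  -- This `t` makes the phase `e^{iπ} = -1`, so the residue equals its own negative.
  have key := residue_eq_exp_mul_residue hV hφ ε (Real.pi / (m - ∑ i, (1 - 2 * w i)))
  rw [div_mul_cancel₀ _ hne'] at key
  simp only [Circle.coe_exp, Complex.exp_pi_mul_I] at key
  exact h (by linear_combination key / 2)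

end Weights

/-! ### Degrees and ages in the sectors -/

section Sectors

variable {N : ℕ}

/-- Setting a variable to zero is harmless, since `0` is homogeneous of every weight; dividing the
weights by `d` normalises the degree to `1`. -/
theorem isWeightedHomogeneous_restrict {W : MvPolynomial (Fin N) ℂ} {c : Fin N → ℕ} {d : ℕ}
    (hW : IsQuasihomogeneous W c d) (S : Finset (Fin N)) :
    (restrict W S).IsWeightedHomogeneous (fun i : S => charge c d i) 1 := by
  classical
  rw [restrict, aeval_def, eval₂_eq]
  refine IsWeightedHomogeneous.sum _ _ _ fun m hm => ?_
  have hwt : ∑ i ∈ m.support, m i • charge c d i = 1 := by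
    have h := hW.homogeneous (mem_support_iff.1 hm)
    rw [Finsupp.weight_apply, Finsupp.sum] at h
    have hd : (d : ℝ) ≠ 0 := by exact_mod_cast hW.degree_pos.ne'
    simp only [charge, nsmul_eq_mul, ← mul_div_assoc, ← Finset.sum_div]
    rw [div_eq_one_iff_eq hd, ← h]
    simp
  refine IsWeightedHomogeneous.C_mul ?_ _
  rw [← hwt]
  refine IsWeightedHomogeneous.prod _ _ _ fun i _ => IsWeightedHomogeneous.pow ?_ _
  split_ifs with hi
  · exact isWeightedHomogeneous_X ℂ (fun i : S => charge c d i) ⟨i, hi⟩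
  · exact isWeightedHomogeneous_zero _ _ _

theorem castForm_mem_homForms {c : Fin N → ℕ} {d : ℕ} {S T : Finset (Fin N)} (h : T = S) {p : ℝ}
    {φ : MvPolynomial T ℂ} (hφ : φ ∈ homForms c d T p) : castForm h φ ∈ homForms c d S p := by
  subst h
  have : castForm rfl φ = φ := rename_id_apply φ
  rwa [this]

open Classical in
theorem phase_add_phase_inv (g : Fin N → Circle) (i : Fin N) :
    phase g i + phase g⁻¹ i = if g i = 1 then 0 else 1 := by
  have hpi := Real.pi_pos
  split_ifs with hg
  · simp [phase, hg]
  have harg : Complex.arg (g i : ℂ) ≠ 0 := fun h => hg (Circle.arg_eq_arg.1 (by simpa using h))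
  -- Since `arg / 2π` lies in `(-1/2, 1/2]`, its only possible integer value is `0`.
  have hfract : Int.fract (Complex.arg (g i : ℂ) / (2 * Real.pi)) ≠ 0 := by
    intro h
    obtain ⟨k, hk⟩ := Int.fract_eq_zero_iff.1 h
    rw [eq_div_iff (by positivity)] at hk
    have h₁ := Complex.neg_pi_lt_arg (g i : ℂ)
    have h₂ := Complex.arg_le_pi (g i : ℂ)
    have hk₁ : (-1 : ℝ) < k := by nlinarith
    have hk₂ : (k : ℝ) < 1 := by nlinarith
    norm_cast at hk₁ hk₂
    obtain rfl : k = 0 := by omega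
    exact harg (by simpa using hk.symm)
  simp only [phase, Pi.inv_apply, Circle.coe_inv, Complex.arg_inv]
  -- At `arg = π` the principal argument of the inverse is again `π`, not `-π`; both phases are
  -- `1/2`.
  split_ifs with h
  · have : Real.pi / (2 * Real.pi) = 1 / 2 := by field_simp
    rw [h, this, Int.fract_eq_self.2 (by norm_num)]
    norm_num
  · rw [neg_div, Int.fract_neg hfract]
    ring

theorem age_add_age_inv (g : Fin N → Circle) :
    age g + age g⁻¹ = N - (fixIdx g).card := by
  classical
  have h : (fixIdx g).card = ∑ i, if g i = 1 then (1 : ℝ) else 0 := by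
    simp [fixIdx]
  rw [age, age, ← Finset.sum_add_distrib, h, eq_sub_iff_add_eq, ← Finset.sum_add_distrib]
  have : ∀ i, phase g i + phase g⁻¹ i + (if g i = 1 then (1 : ℝ) else 0) = 1 := by
    intro i
    rw [phase_add_phase_inv]
    split_ifs <;> simp
  simp [this]

/-- Homogeneous forms that pair nontrivially have complementary internal degrees. -/
theorem degree_add_degree_of_formPairing_ne_zero {W : MvPolynomial (Fin N) ℂ} {c : Fin N → ℕ}
    {d : ℕ} (hW : IsQuasihomogeneous W c d) {g : Fin N → Circle} {ε a b : ℝ}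
    {φ₁ : MvPolynomial (fixIdx g) ℂ} {φ₂ : MvPolynomial (fixIdx g⁻¹) ℂ}
    (h₁ : φ₁ ∈ homForms c d _ a) (h₂ : φ₂ ∈ homForms c d _ b)
    (h : formPairing W ε g φ₁ φ₂ ≠ 0) : a + b = (fixIdx g).card := by
  have h₂' := castForm_mem_homForms (fixIdx_inv g) h₂
  have hprod := IsWeightedHomogeneous.mul ((mem_weightedHomogeneousSubmodule _ _ _ _).1 h₁)
    ((mem_weightedHomogeneousSubmodule _ _ _ _).1 h₂')
  have key := eq_of_residue_ne_zero (isWeightedHomogeneous_restrict hW _) hprod h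
  -- The numerator has weight `a + b - 2∑q_i` and must have weight `n_g - 2∑q_i`, sums over
  -- `Fix(g)`.
  rw [Finset.sum_sub_distrib, ← Finset.mul_sum,
    Finset.sum_coe_sort (fixIdx g) (fun i => charge c d i)] at key
  simp at key
  linarith

theorem shifted_degree_add_of_formPairing_ne_zero {W : MvPolynomial (Fin N) ℂ} {c : Fin N → ℕ}
    {d : ℕ} (hW : IsQuasihomogeneous W c d) {g : Fin N → Circle} {ε a b : ℝ}
    {φ₁ : MvPolynomial (fixIdx g) ℂ} {φ₂ : MvPolynomial (fixIdx g⁻¹) ℂ}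
    (h₁ : φ₁ ∈ homForms c d _ a) (h₂ : φ₂ ∈ homForms c d _ b)
    (h : formPairing W ε g φ₁ φ₂ ≠ 0) :
    (a + shiftMinus c d g) + (b + shiftMinus c d g⁻¹) = centralCharge c d ∧
      (a + shiftPlus c d g) + (b + shiftPlus c d g⁻¹) = centralCharge c d := by
  have hab := degree_add_degree_of_formPairing_ne_zero hW h₁ h₂ h
  have hage := age_add_age_inv g
  have hc : centralCharge c d = N - 2 * ∑ i, charge c d i := by
    simp [centralCharge, Finset.sum_sub_distrib, Finset.mul_sum]
  simp only [shiftMinus, shiftPlus, inv_inv, hc]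
  constructor <;> linarith

/-- A nonzero value cannot be the conventional `0`, so the common value exists and any
representatives compute it. -/
theorem formPairing_eq_pairing {W : MvPolynomial (Fin N) ℂ} {ε : ℝ} {g : Fin N → Circle}
    {φ₁ : MvPolynomial (fixIdx g) ℂ} {φ₂ : MvPolynomial (fixIdx g⁻¹) ℂ}
    (h : pairing W ε g (Submodule.Quotient.mk φ₁) (Submodule.Quotient.mk φ₂) ≠ 0) :
    formPairing W ε g φ₁ φ₂
      = pairing W ε g (Submodule.Quotient.mk φ₁) (Submodule.Quotient.mk φ₂) := by
  rw [pairing] at h ⊢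
  split_ifs at h ⊢ with hex
  · exact hex.choose_spec φ₁ φ₂ rfl rfl
  · exact absurd rfl h

theorem formPairing_zero_left (W : MvPolynomial (Fin N) ℂ) (ε : ℝ) (g : Fin N → Circle)
    (φ₂ : MvPolynomial (fixIdx g⁻¹) ℂ) : formPairing W ε g 0 φ₂ = 0 := by
  simp [formPairing, residue]

theorem formPairing_zero_right (W : MvPolynomial (Fin N) ℂ) (ε : ℝ) (g : Fin N → Circle)
    (φ₁ : MvPolynomial (fixIdx g) ℂ) : formPairing W ε g φ₁ 0 = 0 := by
  simp [formPairing, residue, castForm]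

/-- A nonzero class of bidegree `(p, q)` lies on the diagonal and is represented by a homogeneous
form. -/
theorem exists_homForm_of_mem_omegaBideg {W : MvPolynomial (Fin N) ℂ} {c : Fin N → ℕ} {d : ℕ}
    {S : Finset (Fin N)} {p q : ℝ} {ω : Omega W S} (hω : ω ∈ omegaBideg W c d S p q)
    (h0 : ω ≠ 0) : p = q ∧ ∃ φ ∈ homForms c d S p, Submodule.Quotient.mk φ = ω := by
  rw [omegaBideg] at hω
  split_ifs at hω with hpq
  · exact ⟨hpq, Submodule.mem_map.1 hω⟩
  · exact absurd ((Submodule.mem_bot ℂ).1 hω) h0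

theorem mem_omegaBideg_of_lof_mem {W : MvPolynomial (Fin N) ℂ} {G : Subgroup (Fin N → Circle)}
    {hG : G ≤ maxSymm W} {c : Fin N → ℕ} {d : ℕ} [DecidableEq G] {g : G} {p q : ℝ}
    {ω : Omega W (fixIdx (g : Fin N → Circle))}
    (h : DirectSum.lof ℂ G (fun k => Omega W (fixIdx (k : Fin N → Circle))) g ω
      ∈ OmegaGBideg hG c d p q) :
    ω ∈ omegaBideg W c d _ (p - shiftMinus c d g) (q - shiftPlus c d g) := by
  have := (Submodule.mem_iInf _).1 h.2 g
  rwa [Submodule.mem_comap, DirectSum.component.lof_self] at this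

end Sectors

end

end LG

/-! ### The theorem for forms and for classes -/

open Classical in
theorem mainTheorem2 {N : ℕ} (W : MvPolynomial (Fin N) ℂ) (c : Fin N → ℕ) (d : ℕ)
    (hW : LG.IsQuasihomogeneous W c d) (hnd : LG.IsNondegenerate W) (hinv : LG.IsInvertible W)
    (G : Subgroup (Fin N → Circle)) (hG : G ≤ LG.maxSymm W) (hJ : LG.J c d ∈ G)
    (g : G) (ε : ℝ) (hε : 0 < ε) :
    -- for homogeneous forms `φ₁ dx_g`, `φ₂ dx_{g⁻¹}` of internal degrees `a`, `b`
    (∀ (a b : ℝ) (φ₁ : MvPolynomial (LG.fixIdx (g : Fin N → Circle)) ℂ)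
        (φ₂ : MvPolynomial (LG.fixIdx (g : Fin N → Circle)⁻¹) ℂ),
        φ₁ ∈ LG.homForms c d _ a → φ₂ ∈ LG.homForms c d _ b →
        LG.formPairing W ε g φ₁ φ₂ ≠ 0 →
        (a + LG.shiftMinus c d g) + (b + LG.shiftMinus c d (g : Fin N → Circle)⁻¹)
            = LG.centralCharge c d ∧
          (a + LG.shiftPlus c d g) + (b + LG.shiftPlus c d (g : Fin N → Circle)⁻¹)
            = LG.centralCharge c d) ∧
    -- for bihomogeneous elements of the `g`- and `g⁻¹`-sectors of `Ω_{W,G}`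
    (∀ (p q p' q' : ℝ) (ω₁ : LG.Omega W (LG.fixIdx (g : Fin N → Circle)))
        (ω₂ : LG.Omega W (LG.fixIdx ((g⁻¹ : G) : Fin N → Circle))),
        DirectSum.lof ℂ G (fun k => LG.Omega W (LG.fixIdx (k : Fin N → Circle))) g ω₁
          ∈ LG.OmegaGBideg hG c d p q →
        DirectSum.lof ℂ G (fun k => LG.Omega W (LG.fixIdx (k : Fin N → Circle))) g⁻¹ ω₂
          ∈ LG.OmegaGBideg hG c d p' q' →
        LG.pairing W ε g ω₁ ω₂ ≠ 0 →
        p + p' = LG.centralCharge c d ∧ q + q' = LG.centralCharge c d) := by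
  refine ⟨fun a b φ₁ φ₂ h₁ h₂ h =>
    LG.shifted_degree_add_of_formPairing_ne_zero hW h₁ h₂ h, ?_⟩
  intro p q p' q' ω₁ ω₂ h₁ h₂ h
  -- The zero class lies in every bidegree, so nonvanishing must be known before the bidegree says
  -- anything.
  have hω₁ : ω₁ ≠ 0 := by
    rintro rfl
    obtain ⟨φ₂, rfl⟩ := Submodule.Quotient.mk_surjective _ ω₂
    exact h ((LG.formPairing_eq_pairing (φ₁ := 0) h).symm.trans
      (LG.formPairing_zero_left W ε g φ₂))
  have hω₂ : ω₂ ≠ 0 := by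
    rintro rfl
    obtain ⟨φ₁, rfl⟩ := Submodule.Quotient.mk_surjective _ ω₁
    exact h ((LG.formPairing_eq_pairing (φ₂ := 0) h).symm.trans
      (LG.formPairing_zero_right W ε g φ₁))
  obtain ⟨e₁, φ₁, hφ₁, rfl⟩ :=
    LG.exists_homForm_of_mem_omegaBideg (LG.mem_omegaBideg_of_lof_mem h₁) hω₁
  obtain ⟨e₂, φ₂, hφ₂, rfl⟩ :=
    LG.exists_homForm_of_mem_omegaBideg (LG.mem_omegaBideg_of_lof_mem h₂) hω₂
  have hne : LG.formPairing W ε g φ₁ φ₂ ≠ 0 := by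
    rw [LG.formPairing_eq_pairing h]
    exact h
  obtain ⟨hm, hp⟩ := LG.shifted_degree_add_of_formPairing_ne_zero hW hφ₁ hφ₂ hne
  -- The representatives have internal degree `p - Q^B_-`; by the diagonal conditions `e₁`, `e₂`
  -- this is also `q - Q^B_+`, which turns `hp` into the claim on `q + q'`.
  rw [InvMemClass.coe_inv] at e₂ hm hp
  constructor <;> linarith
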